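/- Let $F$ be a field, let $n$ be a positive integer, let $K_n$ be the complete graph on the vertex set $[n]=\{1,\dots,n\}$, and let $S=F[x_1,\dots,x_n,y_1,\dots,y_n]$. The parity binomial edge ideal of a graph $G$ on $[n]$ is $\mathcal{I}_G=\langle x_ix_j-y_iy_j : \{i,j\}\in E(G)\rangle\subseteq S$. An $(i,j)$-path of length $r$ in $G$ is a sequence of vertices $\pi=(i_0,\dots,i_r)$ with $i_0=i$, $i_r=j$ and $\{i_k,i_{k+1}\}\in E(G)$ for all $0\le k<r$ (vertices may be repeated); its parity is the parity of $r$, and its interior is $\mathrm{int}(\pi)=\{i_0,\dots,i_r\}\setminus\{i,j\}$. An $(i,j)$-path $\pi$ is minimal if (i) for no $k\in\mathrm{int}(\pi)$ there is an $(i,j)$-path of the same parity as $\pi$ in the subgraph of $G$ induced on the vertices of $\pi$ other than $k$, and (ii) there is no $(i,j)$-path $\pi'$ in $G$ that is shorter than $\pi$ and has the same parity and the same interior as $\pi$. For a minimal $(i,j)$-path $\pi$ let $\mathcal{S}_\pi$ be the set of all polynomials $\pm(x_ix_j-y_iy_j)\prod_{k\in\mathrm{int}(\pi)}t_k$ if $\pi$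 is odd, and of all polynomials $(x_iy_j-y_ix_j)\prod_{k\in\mathrm{int}(\pi)}t_k$ if $\pi$ is even, where each $t_k\in\{x_k,y_k\}$ is arbitrary. Let $\mathcal{S}(\mathcal{I}_G)=\bigcup_\pi\mathcal{S}_\pi\setminus\{0\}$, where $\pi$ runs over all minimal paths in $G$. The universal Gröbner basis of an ideal of $S$ is the union of its reduced Gröbner bases over all monomial orders on $S$. A binomial is a difference $\mathbf{x}^u-\mathbf{x}^v$ of two distinct monic monomials. The Graver basis of an ideal $I$ generated by binomials is the set of its primitive binomials, that is, of the binomials $\mathbf{x}^u-\mathbf{x}^v\in I$ such that there is no other binomial $\mathbf{x}^{u'}-\mathbf{x}^{v'}\in I$ with $\mathbf{x}^{u'}\mid\mathbf{x}^u$ and $\mathbf{x}^{v'}\mid\mathbf{x}^v$. Then the set $\mathcal{S}(\mathcal{I}_{K_n})$, the universal Gröbner basis of $\mathcal{I}_{K_n}$ and the Graver basis of $\mathcal{I}_{K_n}$ coincide. Moreover, the minimal paths in $K_n$ are exactly the paths $(i)$, $(i,j)$, $(i,k,j)$ and $(i,k,l,i)$, where $i,j,k,l$ denote distinct elements of $[n]$.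 -/

import Mathlib

open MvPolynomial

universe u v

noncomputable section

/-- The variable `x_i` of the polynomial ring in the variables `x_i, y_i` (`i ∈ V`). -/
def xVar {V : Type u} (F : Type v) [Field F] (i : V) : MvPolynomial (V ⊕ V) F :=
  X (Sum.inl i)

/-- The variable `y_i` of the polynomial ring in the variables `x_i, y_i` (`i ∈ V`). -/
def yVar {V : Type u} (F : Type v) [Field F] (i : V) : MvPolynomial (V ⊕ V) F :=
  X (Sum.inr i)

/-- The parity binomial edge ideal of `G`, generated by `x_i x_j - y_i y_j`, `{i,j}` an edge. -/
def parityBinomialEdgeIdeal {V : Type u} (F : Type v) [Field F] (G : SimpleGraph V) :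
    Ideal (MvPolynomial (V ⊕ V) F) :=
  Ideal.span {f | ∃ i j : V, G.Adj i j ∧ f = xVar F i * xVar F j - yVar F i * yVar F j}

/-- The interior of an `(i,j)`-path: its set of vertices without `i` and `j`.
A path is an arbitrary sequence of consecutively adjacent vertices, i.e. a walk. -/
def pathInterior {V : Type u} [DecidableEq V] {G : SimpleGraph V} {i j : V}
    (p : G.Walk i j) : Finset V :=
  p.support.toFinset \ {i, j}

/-- Minimal `(i,j)`-paths. In the first condition, a path in the subgraph induced on the vertices
of `p` other than `k` is a path in `G` all of whose vertices are vertices of `p` other than `k`. -/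
def IsMinimalPath {V : Type u} [DecidableEq V] {G : SimpleGraph V} {i j : V}
    (p : G.Walk i j) : Prop :=
  (∀ k ∈ pathInterior p, ¬ ∃ q : G.Walk i j,
      (Even q.length ↔ Even p.length) ∧ ∀ w ∈ q.support, w ∈ p.support ∧ w ≠ k) ∧
  ¬ ∃ q : G.Walk i j, q.length < p.length ∧ (Even q.length ↔ Even p.length) ∧
      pathInterior q = pathInterior p

/-- The set `S_π` of binomials attached to a path `π = p`. -/
def pathBinomials {V : Type u} [DecidableEq V] (F : Type v) [Field F] {G : SimpleGraph V}
    {i j : V} (p : G.Walk i j) : Set (MvPolynomial (V ⊕ V) F) :=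
  {f | ∃ t : V → MvPolynomial (V ⊕ V) F, (∀ k, t k = xVar F k ∨ t k = yVar F k) ∧
    ((Odd p.length ∧
        (f = (xVar F i * xVar F j - yVar F i * yVar F j) * ∏ k ∈ pathInterior p, t k ∨
         f = (yVar F i * yVar F j - xVar F i * xVar F j) * ∏ k ∈ pathInterior p, t k)) ∨
      (Even p.length ∧
        f = (xVar F i * yVar F j - yVar F i * xVar F j) * ∏ k ∈ pathInterior p, t k))}

/-- The set of nonzero binomials attached to the minimal paths of `G`. -/
def minimalPathBinomials {V : Type u} [DecidableEq V] (F : Type v) [Field F]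
    (G : SimpleGraph V) : Set (MvPolynomial (V ⊕ V) F) :=
  {f | ∃ (i j : V) (p : G.Walk i j), IsMinimalPath p ∧ f ∈ pathBinomials F p} \ {0}

/-- `B` is the reduced Gröbner basis of `I` with respect to the monomial order `m`: it is a finite
subset of `I` whose leading terms generate the initial ideal of `I`, its elements have leading
coefficient `1`, and no monomial of an element of `B` is divisible by the leading monomial
of another element of `B`. -/
def IsReducedGroebnerBasis {σ : Type u} {F : Type v} [Field F] (m : MonomialOrder.{u, u} σ)
    (I : Ideal (MvPolynomial σ F)) (B : Set (MvPolynomial σ F)) : Prop :=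
  B.Finite ∧ B ⊆ I ∧
  Ideal.span (m.leadingTerm '' B) = Ideal.span (m.leadingTerm '' (I : Set (MvPolynomial σ F))) ∧
  (∀ b ∈ B, m.leadingCoeff b = 1) ∧
  ∀ b ∈ B, ∀ b' ∈ B, b' ≠ b → ∀ d ∈ b.support, ¬ m.degree b' ≤ d

/-- The universal Gröbner basis of `I`: the union of its reduced Gröbner bases over all monomial
orders. (Every monomial order on `σ →₀ ℕ` can be realised on a type in the universe of `σ`.) -/
def universalGroebnerBasis {σ : Type u} {F : Type v} [Field F] (I : Ideal (MvPolynomial σ F)) :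
    Set (MvPolynomial σ F) :=
  {f | ∃ (m : MonomialOrder.{u, u} σ) (B : Set (MvPolynomial σ F)),
    IsReducedGroebnerBasis m I B ∧ f ∈ B}

/-- The Graver basis of `I`: the set of primitive binomials of `I`. A binomial is a
difference of two distinct monic monomials. -/
def graverBasis {σ : Type u} {F : Type v} [Field F] (I : Ideal (MvPolynomial σ F)) :
    Set (MvPolynomial σ F) :=
  {f | ∃ a b : σ →₀ ℕ, a ≠ b ∧ f = monomial a 1 - monomial b 1 ∧ f ∈ I ∧
    ∀ a' b' : σ →₀ ℕ, a' ≠ b' → (monomial a' 1 - monomial b' 1 : MvPolynomial σ F) ∈ I →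
      a' ≤ a → b' ≤ b → a' = a ∧ b' = b}

end

/-!
Let `a ~ b` mean that `x^a - x^b` lies in the ideal of the complete graph. This is the congruence
on exponents generated by the moves along the edges, so additive weights that every move preserves
are constant on its classes. They show that `b - a` is `a - b` with `x_i` and `y_i` exchanged, and
that `a - b` has even degree. If two variables of the same kind at different vertices occur in
`a - b`, they form the binomial of an edge. Otherwise `a - b` lives on at most one `x`-vertex and
one `y`-vertex, and a weight with values `1` and `-1` forces further vertices in the support of
`a`, as many as the path between the two vertices needs in its interior. Hence for `a ≠ b` the two
monomials of some path binomial divide `x^a` and `x^b`, so every primitive binomial is a path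
binomial.

Elements of the reduced Gröbner bases of an ideal generated by binomials are primitive binomials.
Conversely, let `x^a - x^b` be a path binomial and take a monomial order in which the variables of
`x^b` have weight `0`, the other variables of `x^a` weight `1`, and the remaining variables a weight
larger than that of `x^a`. Only path binomials in the variables of `x^a x^b` can interfere, and
among these no other one has a monomial dividing `x^a`; hence `x^a` is a minimal generator of the
initial ideal with normal form `x^b`.

A path in a complete graph is minimal exactly if its length is at most one more than the number of
interior vertices that its ends and its parity force: `0`, `1` or `2`.
-/

open scoped MonomialOrder

section WeightOrder

variable {σ : Type u}

/-- The additive embedding of the exponents that puts the weight in front: the lexicographic order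
of its target compares the weights `w` first and breaks ties by `m`. -/
noncomputable def weightKey (m : MonomialOrder.{u, u} σ) (w : (σ →₀ ℕ) →+ ℕ) :
    (σ →₀ ℕ) →+ ℕ ×ₗ m.syn where
  toFun a := toLex (w a, m.toSyn a)
  map_zero' := by simp only [map_zero]; rfl
  map_add' a b := by simp only [map_add]; rfl

theorem weightKey_injective (m : MonomialOrder.{u, u} σ) (w : (σ →₀ ℕ) →+ ℕ) :
    Function.Injective (weightKey m w) := fun _ _ h =>
  m.toSyn.injective (congrArg (fun x => (ofLex x).2) h)

/-- The monomial order that compares the weights `w` first and breaks ties by `m`. It is realised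
on the range of `weightKey m w`, because the full lexicographic product is larger. -/
noncomputable def weightOrder (m : MonomialOrder.{u, u} σ) (w : (σ →₀ ℕ) →+ ℕ) :
    MonomialOrder.{u, u} σ where
  syn := AddMonoidHom.mrange (weightKey m w)
  addCommMonoidSyn := (AddMonoidHom.mrange (weightKey m w)).toAddCommMonoid
  toSyn :=
    { Equiv.ofBijective (weightKey m w).mrangeRestrict
        ⟨fun _ _ h => weightKey_injective m w (congrArg Subtype.val h),
          (weightKey m w).mrangeRestrict_surjective⟩ with
      map_add' := fun a b => Subtype.ext (map_add (weightKey m w) a b) }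
  toSyn_monotone a b h := by
    obtain ⟨c, rfl⟩ := le_iff_exists_add.1 h
    have hw : w a ≤ w (a + c) := by simp only [map_add, le_add_iff_nonneg_right, zero_le]
    exact Subtype.coe_le_coe.1 (Prod.Lex.toLex_le_toLex'.2 ⟨hw, fun _ => m.toSyn_monotone h⟩)

theorem weightOrder_lt_of_lt (m : MonomialOrder.{u, u} σ) {w : (σ →₀ ℕ) →+ ℕ} {a b : σ →₀ ℕ}
    (h : w a < w b) : a ≺[weightOrder m w] b :=
  Subtype.coe_lt_coe.1 (Prod.Lex.lt_iff.2 (Or.inl h))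

theorem exists_monomialOrder_of_weight [Finite σ] (w : (σ →₀ ℕ) →+ ℕ) :
    ∃ m : MonomialOrder.{u, u} σ, ∀ a b : σ →₀ ℕ, a ≼[m] b → w a ≤ w b := by
  let _ : LinearOrder σ := IsWellOrder.linearOrder WellOrderingRel
  exact ⟨weightOrder MonomialOrder.lex w, fun a b hab =>
    not_lt.1 fun hlt => hab.not_gt (weightOrder_lt_of_lt _ hlt)⟩

end WeightOrder

section BinomialIdeal

variable {σ : Type u} {F : Type v} [Field F]

/-- The congruence on exponents that relates `a` and `b` when `x^a - x^b` lies in the ideal `I`. -/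
def binomialCon (I : Ideal (MvPolynomial σ F)) : AddCon (σ →₀ ℕ) where
  r a b := (monomial a 1 - monomial b 1 : MvPolynomial σ F) ∈ I
  iseqv :=
    { refl := fun a => by simp only [sub_self, zero_mem]
      symm := fun h => by simpa only [neg_sub] using I.neg_mem h
      trans := fun h h' => by simpa only [sub_add_sub_cancel] using I.add_mem h h' }
  add' {a b c d} h h' := by
    have := I.add_mem (I.mul_mem_right (monomial c 1) h) (I.mul_mem_left (monomial b 1) h')
    simpa only [sub_mul, mul_sub, monomial_mul, mul_one, sub_add_sub_cancel] using this

theorem binomialCon_iff {I : Ideal (MvPolynomial σ F)} {a b : σ →₀ ℕ} :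
    binomialCon I a b ↔ (monomial a 1 - monomial b 1 : MvPolynomial σ F) ∈ I :=
  Iff.rfl

/-- The ideal generated by the binomials `x^a - x^b` with `R a b`. -/
noncomputable def binomialIdeal (F : Type v) [Field F] (R : (σ →₀ ℕ) → (σ →₀ ℕ) → Prop) :
    Ideal (MvPolynomial σ F) :=
  Ideal.span {f | ∃ a b, R a b ∧ f = monomial a 1 - monomial b 1}

variable {R : (σ →₀ ℕ) → (σ →₀ ℕ) → Prop}

theorem mapDomainRingHom_monomial_one {M : Type*} [AddCommMonoid M] (φ : (σ →₀ ℕ) →+ M)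
    (a : σ →₀ ℕ) : AddMonoidAlgebra.mapDomainRingHom F φ (monomial a 1) =
      AddMonoidAlgebra.single (φ a) 1 :=
  AddMonoidAlgebra.mapDomain_single

theorem binomialIdeal_le_ker_mapDomainRingHom (F : Type v) [Field F]
    (R : (σ →₀ ℕ) → (σ →₀ ℕ) → Prop) : binomialIdeal F R ≤
      RingHom.ker (AddMonoidAlgebra.mapDomainRingHom F (addConGen R).mk') := by
  refine Ideal.span_le.2 ?_
  rintro _ ⟨a, b, hab, rfl⟩
  have hmk : (addConGen R).mk' a = (addConGen R).mk' b :=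
    (AddCon.eq _).2 (AddConGen.Rel.of a b hab)
  rw [SetLike.mem_coe, RingHom.mem_ker, map_sub, mapDomainRingHom_monomial_one,
    mapDomainRingHom_monomial_one, hmk, sub_self]

theorem binomialCon_binomialIdeal (F : Type v) [Field F] (R : (σ →₀ ℕ) → (σ →₀ ℕ) → Prop) :
    binomialCon (binomialIdeal F R) = addConGen R := by
  refine le_antisymm (fun a b hab => ?_)
    (AddCon.addConGen_le.2 fun a b hab => Ideal.subset_span ⟨a, b, hab, rfl⟩)
  have hker := binomialIdeal_le_ker_mapDomainRingHom F R hab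
  rw [RingHom.mem_ker, map_sub, mapDomainRingHom_monomial_one, mapDomainRingHom_monomial_one,
    sub_eq_zero] at hker
  exact (AddCon.eq _).1 ((AddMonoidAlgebra.single_left_inj one_ne_zero).1 hker)

/- The coefficients of an element of the ideal sum up to zero over each class of exponents. -/
theorem exists_mem_support_binomialCon {f : MvPolynomial σ F} (hf : f ∈ binomialIdeal F R)
    {a : σ →₀ ℕ} (ha : a ∈ f.support) :
    ∃ b ∈ f.support, b ≠ a ∧ binomialCon (binomialIdeal F R) a b := by
  classical
  rw [binomialCon_binomialIdeal]
  let φ : (σ →₀ ℕ) →+ (addConGen R).Quotient := (addConGen R).mk'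
  have hker := binomialIdeal_le_ker_mapDomainRingHom F R hf
  have hsum : ∑ b ∈ f.support with φ b = φ a, f.coeff b = 0 :=
    (Finsupp.mapDomain_apply_eq_sum φ _).symm.trans
      (DFunLike.congr_fun (congrArg AddMonoidAlgebra.coeff (RingHom.mem_ker.1 hker)) (φ a))
  by_contra! h
  have hclass : {b ∈ f.support | φ b = φ a} = {a} := by
    ext b
    rw [Finset.mem_filter, Finset.mem_singleton]
    refine ⟨fun ⟨hb, hφ⟩ => ?_, by rintro rfl; exact ⟨ha, rfl⟩⟩
    by_contra hne
    exact h b hb hne ((AddCon.eq _).1 hφ.symm)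
  rw [hclass, Finset.sum_singleton] at hsum
  exact mem_support_iff.1 ha hsum

/-- The exponents that are not the smallest ones in their class modulo `I`. -/
def nonstandardExponents (m : MonomialOrder.{u, u} σ) (I : Ideal (MvPolynomial σ F)) :
    Set (σ →₀ ℕ) :=
  {a | ∃ b, binomialCon I a b ∧ b ≺[m] a}

section Standard

variable {m : MonomialOrder.{u, u} σ} {I : Ideal (MvPolynomial σ F)} {a b : σ →₀ ℕ}

theorem isUpperSet_nonstandardExponents : IsUpperSet (nonstandardExponents m I) := by
  rintro a a' h ⟨b, hab, hlt⟩
  obtain ⟨u, rfl⟩ := le_iff_exists_add'.1 h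
  refine ⟨u + b, (binomialCon I).add ((binomialCon I).refl u) hab, ?_⟩
  rw [map_add, map_add]
  exact add_lt_add_right hlt _

theorem exists_notMem_nonstandardExponents (m : MonomialOrder.{u, u} σ)
    (I : Ideal (MvPolynomial σ F)) (a : σ →₀ ℕ) :
    ∃ b, binomialCon I a b ∧ b ∉ nonstandardExponents m I := by
  obtain ⟨b, hb, hmin⟩ := (InvImage.wf m.toSyn wellFounded_lt).has_min
    {b | binomialCon I a b} ⟨a, (binomialCon I).refl a⟩
  exact ⟨b, hb, fun ⟨c, hc, hlt⟩ => hmin c ((binomialCon I).trans hb hc) hlt⟩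

theorem le_of_notMem_nonstandardExponents (h : binomialCon I a b)
    (hb : b ∉ nonstandardExponents m I) : b ≼[m] a :=
  not_lt.1 fun hlt => hb ⟨a, (binomialCon I).symm h, hlt⟩

theorem eq_of_notMem_nonstandardExponents (h : binomialCon I a b)
    (ha : a ∉ nonstandardExponents m I) (hb : b ∉ nonstandardExponents m I) : a = b :=
  m.toSyn.injective (le_antisymm (le_of_notMem_nonstandardExponents ((binomialCon I).symm h) ha)
    (le_of_notMem_nonstandardExponents h hb))

theorem degree_mem_nonstandardExponents {f : MvPolynomial σ F} (hf : f ∈ binomialIdeal F R)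
    (h0 : f ≠ 0) : m.degree f ∈ nonstandardExponents m (binomialIdeal F R) := by
  obtain ⟨b, hb, hne, h⟩ := exists_mem_support_binomialCon hf (m.degree_mem_support h0)
  exact ⟨b, h, lt_of_le_of_ne (m.le_degree hb) (m.toSyn.injective.ne hne)⟩

theorem eq_zero_of_forall_notMem_nonstandardExponents {f : MvPolynomial σ F}
    (hf : f ∈ binomialIdeal F R)
    (hs : ∀ d ∈ f.support, d ∉ nonstandardExponents m (binomialIdeal F R)) : f = 0 := by
  by_contra h0
  exact hs _ (m.degree_mem_support h0) (degree_mem_nonstandardExponents hf h0)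

theorem degree_monomial_sub_monomial (h : b ≺[m] a) :
    m.degree (monomial a 1 - monomial b 1 : MvPolynomial σ F) = a := by
  classical
  have hdeg (c : σ →₀ ℕ) : m.degree (monomial c 1 : MvPolynomial σ F) = c := by
    rw [m.degree_monomial, if_neg one_ne_zero]
  rw [m.degree_sub_of_lt (by rwa [hdeg, hdeg]), hdeg]

theorem leadingCoeff_monomial_sub_monomial (h : b ≺[m] a) :
    m.leadingCoeff (monomial a 1 - monomial b 1 : MvPolynomial σ F) = 1 := by
  classical
  have hba : b ≠ a := fun hba => h.ne (congrArg m.toSyn hba)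
  rw [MonomialOrder.leadingCoeff, degree_monomial_sub_monomial h, coeff_sub, coeff_monomial,
    coeff_monomial, if_pos rfl, if_neg hba, sub_zero]

theorem mem_span_monomial_image_iff {S : Set (σ →₀ ℕ)} :
    monomial a (1 : F) ∈ Ideal.span ((fun s => monomial s (1 : F)) '' S) ↔ ∃ s ∈ S, s ≤ a := by
  classical
  simp [mem_ideal_span_monomial_image, support_monomial]

theorem span_leadingTerm_image_of_monic {B : Set (MvPolynomial σ F)}
    (hB : ∀ b ∈ B, m.leadingCoeff b = 1) :
    Ideal.span (m.leadingTerm '' B) =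
      Ideal.span ((fun s => monomial s (1 : F)) '' (m.degree '' B)) := by
  rw [Set.image_image]
  congr 1
  refine Set.image_congr fun b hb => ?_
  rw [MonomialOrder.leadingTerm, hB b hb]

theorem span_leadingTerm_binomialIdeal (m : MonomialOrder.{u, u} σ)
    (R : (σ →₀ ℕ) → (σ →₀ ℕ) → Prop) :
    Ideal.span (m.leadingTerm '' (binomialIdeal F R : Set (MvPolynomial σ F))) =
      Ideal.span ((fun s => monomial s (1 : F)) ''
        nonstandardExponents m (binomialIdeal F R)) := by
  apply le_antisymm <;> rw [Ideal.span_le]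
  · rintro _ ⟨f, hf, rfl⟩
    by_cases h0 : f = 0
    · rw [h0, m.leadingTerm_zero]
      exact zero_mem _
    · rw [MonomialOrder.leadingTerm, SetLike.mem_coe, ← mul_one (m.leadingCoeff f),
        ← C_mul_monomial]
      exact Ideal.mul_mem_left _ _
        (Ideal.subset_span ⟨_, degree_mem_nonstandardExponents hf h0, rfl⟩)
  · rintro _ ⟨a, ⟨b, hab, hlt⟩, rfl⟩
    refine Ideal.subset_span ⟨_, hab, ?_⟩
    rw [MonomialOrder.leadingTerm, degree_monomial_sub_monomial hlt,
      leadingCoeff_monomial_sub_monomial hlt]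

theorem IsReducedGroebnerBasis.exists_degree_le {B : Set (MvPolynomial σ F)}
    (hB : IsReducedGroebnerBasis m (binomialIdeal F R) B)
    (ha : a ∈ nonstandardExponents m (binomialIdeal F R)) : ∃ g ∈ B, m.degree g ≤ a := by
  obtain ⟨-, -, hspan, hmonic, -⟩ := hB
  rw [span_leadingTerm_image_of_monic hmonic, span_leadingTerm_binomialIdeal] at hspan
  have h := mem_span_monomial_image_iff (F := F).2 ⟨a, ha, le_rfl⟩
  rw [← hspan, mem_span_monomial_image_iff] at h
  obtain ⟨_, ⟨g, hg, rfl⟩, hle⟩ := h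
  exact ⟨g, hg, hle⟩

/-- The leading exponent `a` and the trailing exponent `b` of an element of the reduced Gröbner
basis of a binomial ideal `I`: the exponent `a` is a minimal generator of the initial ideal and `b`
is its normal form. -/
structure IsReducedBinomial (m : MonomialOrder.{u, u} σ) (I : Ideal (MvPolynomial σ F))
    (a b : σ →₀ ℕ) : Prop where
  minimal : Minimal (· ∈ nonstandardExponents m I) a
  standard : b ∉ nonstandardExponents m I
  rel : binomialCon I a b

theorem IsReducedBinomial.lt (h : IsReducedBinomial m I a b) : b ≺[m] a :=
  lt_of_le_of_ne (le_of_notMem_nonstandardExponents h.rel h.standard)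
    fun hba => h.standard (m.toSyn.injective hba ▸ h.minimal.prop)

theorem IsReducedBinomial.mem_graverBasis (h : IsReducedBinomial m I a b) :
    (monomial a 1 - monomial b 1 : MvPolynomial σ F) ∈ graverBasis I := by
  refine ⟨a, b, fun hab => h.lt.ne (congrArg m.toSyn hab.symm), rfl, h.rel,
    fun a' b' hne hab' ha' hb' => ?_⟩
  have hb's : b' ∉ nonstandardExponents m I :=
    fun hb'n => h.standard (isUpperSet_nonstandardExponents hb' hb'n)
  have ha'n : a' ∈ nonstandardExponents m I :=
    ⟨b', hab', lt_of_le_of_ne (le_of_notMem_nonstandardExponents hab' hb's)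
      (m.toSyn.injective.ne hne.symm)⟩
  obtain rfl : a' = a := h.minimal.eq_of_le ha'n ha'
  exact ⟨rfl, eq_of_notMem_nonstandardExponents
    ((binomialCon I).trans ((binomialCon I).symm hab') h.rel) hb's h.standard⟩

/-- The binomials that make up the reduced Gröbner basis of a binomial ideal `I`. -/
def reducedBinomials (m : MonomialOrder.{u, u} σ) (I : Ideal (MvPolynomial σ F)) :
    Set (MvPolynomial σ F) :=
  {f | ∃ a b, IsReducedBinomial m I a b ∧ f = monomial a 1 - monomial b 1}

theorem IsReducedGroebnerBasis.minimal_degree {B : Set (MvPolynomial σ F)}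
    (hB : IsReducedGroebnerBasis m (binomialIdeal F R) B) {f : MvPolynomial σ F} (hf : f ∈ B) :
    Minimal (· ∈ nonstandardExponents m (binomialIdeal F R)) (m.degree f) := by
  obtain ⟨-, hsub, -, hmonic, hred⟩ := id hB
  have h0 : f ≠ 0 := by
    rintro rfl
    exact zero_ne_one (m.leadingCoeff_zero.symm.trans (hmonic 0 hf))
  refine ⟨degree_mem_nonstandardExponents (hsub hf) h0, fun c hc hle => ?_⟩
  obtain ⟨g, hg, hgc⟩ := hB.exists_degree_le hc
  by_cases hgf : g = f
  · exact hgf ▸ hgc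
  · exact absurd (hgc.trans hle) (hred f hf g hg hgf _ (m.degree_mem_support h0))

theorem IsReducedGroebnerBasis.notMem_nonstandardExponents {B : Set (MvPolynomial σ F)}
    (hB : IsReducedGroebnerBasis m (binomialIdeal F R) B) {f : MvPolynomial σ F} (hf : f ∈ B)
    {d : σ →₀ ℕ} (hd : d ∈ f.support) (hne : d ≠ m.degree f) :
    d ∉ nonstandardExponents m (binomialIdeal F R) := by
  intro hdn
  obtain ⟨g, hg, hgd⟩ := hB.exists_degree_le hdn
  by_cases hgf : g = f
  · subst hgf
    exact hne (m.toSyn.injective (le_antisymm (m.le_degree hd) (m.toSyn_monotone hgd)))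
  · exact hB.2.2.2.2 f hf g hg hgf d hd hgd

theorem IsReducedGroebnerBasis.subset_reducedBinomials {B : Set (MvPolynomial σ F)}
    (hB : IsReducedGroebnerBasis m (binomialIdeal F R) B) :
    B ⊆ reducedBinomials m (binomialIdeal F R) := by
  classical
  intro f hf
  obtain ⟨b, hab, hb⟩ :=
    exists_notMem_nonstandardExponents m (binomialIdeal F R) (m.degree f)
  have hred : IsReducedBinomial m (binomialIdeal F R) (m.degree f) b :=
    ⟨hB.minimal_degree hf, hb, hab⟩
  refine ⟨m.degree f, b, hred, sub_eq_zero.1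
    (eq_zero_of_forall_notMem_nonstandardExponents (m := m) (Ideal.sub_mem _ (hB.2.1 hf) hab) ?_)⟩
  intro d hd
  have hba : b ≠ m.degree f := fun h => hred.lt.ne (congrArg m.toSyn h)
  have hlead : coeff (m.degree f) f = 1 := hB.2.2.2.1 f hf
  have hda : d ≠ m.degree f := by
    rintro rfl
    simp [coeff_monomial, hba, hlead] at hd
  by_cases hdb : d = b
  · exact hdb ▸ hb
  · refine hB.notMem_nonstandardExponents hf ?_ hda
    simpa [coeff_monomial, hda.symm, Ne.symm hdb] using hd

theorem universalGroebnerBasis_subset_graverBasis (R : (σ →₀ ℕ) → (σ →₀ ℕ) → Prop) :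
    universalGroebnerBasis (binomialIdeal F R) ⊆ graverBasis (binomialIdeal F R) := by
  rintro f ⟨m, B, hB, hf⟩
  obtain ⟨a, b, hab, rfl⟩ := hB.subset_reducedBinomials hf
  exact hab.mem_graverBasis

theorem finite_reducedBinomials [Finite σ] (m : MonomialOrder.{u, u} σ)
    (I : Ideal (MvPolynomial σ F)) : (reducedBinomials m I).Finite := by
  have hfin : {a | Minimal (· ∈ nonstandardExponents m I) a}.Finite :=
    WellQuasiOrderedLE.finite_of_isAntichain (setOfPred_minimal_antichain _)
  choose nf hnf hstd using exists_notMem_nonstandardExponents m I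
  refine (hfin.image fun a => (monomial a 1 - monomial (nf a) 1 : MvPolynomial σ F)).subset ?_
  rintro _ ⟨a, b, h, rfl⟩
  obtain rfl : nf a = b := eq_of_notMem_nonstandardExponents
    ((binomialCon I).trans ((binomialCon I).symm (hnf a)) h.rel) (hstd a) h.standard
  exact ⟨a, h.minimal, rfl⟩

theorem leadingCoeff_eq_one_of_mem_reducedBinomials {f : MvPolynomial σ F}
    (hf : f ∈ reducedBinomials m I) : m.leadingCoeff f = 1 := by
  obtain ⟨a, b, h, rfl⟩ := hf
  exact leadingCoeff_monomial_sub_monomial h.lt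

theorem span_leadingTerm_reducedBinomials (m : MonomialOrder.{u, u} σ)
    (R : (σ →₀ ℕ) → (σ →₀ ℕ) → Prop) :
    Ideal.span (m.leadingTerm '' reducedBinomials m (binomialIdeal F R)) =
      Ideal.span (m.leadingTerm '' (binomialIdeal F R : Set (MvPolynomial σ F))) := by
  refine le_antisymm (Ideal.span_mono (Set.image_mono ?_)) ?_
  · rintro _ ⟨a, b, h, rfl⟩
    exact h.rel
  · rw [span_leadingTerm_binomialIdeal, Ideal.span_le,
      span_leadingTerm_image_of_monic fun _ => leadingCoeff_eq_one_of_mem_reducedBinomials]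
    rintro _ ⟨c, hc, rfl⟩
    obtain ⟨a, hac, ha⟩ := exists_minimal_le_of_wellFoundedLT
      (· ∈ nonstandardExponents m (binomialIdeal F R)) c hc
    obtain ⟨b, hab, hb⟩ := exists_notMem_nonstandardExponents m (binomialIdeal F R) a
    have h : IsReducedBinomial m (binomialIdeal F R) a b := ⟨ha, hb, hab⟩
    exact mem_span_monomial_image_iff.2
      ⟨a, ⟨_, ⟨a, b, h, rfl⟩, degree_monomial_sub_monomial h.lt⟩, hac⟩

theorem isReducedGroebnerBasis_reducedBinomials [Finite σ] (m : MonomialOrder.{u, u} σ)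
    (R : (σ →₀ ℕ) → (σ →₀ ℕ) → Prop) :
    IsReducedGroebnerBasis m (binomialIdeal F R)
      (reducedBinomials m (binomialIdeal F R)) := by
  classical
  refine ⟨finite_reducedBinomials m _, ?_, span_leadingTerm_reducedBinomials m R,
    fun _ => leadingCoeff_eq_one_of_mem_reducedBinomials, ?_⟩
  · rintro _ ⟨a, b, h, rfl⟩
    exact h.rel
  · rintro _ ⟨a, b, h, rfl⟩ _ ⟨a', b', h', rfl⟩ hne d hd hle
    rw [degree_monomial_sub_monomial h'.lt] at hle
    have hdab : d = a ∨ d = b := by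
      simpa [support_monomial] using support_sub σ _ _ hd
    obtain rfl | rfl := hdab
    · obtain rfl : a' = d := h.minimal.eq_of_le h'.minimal.prop hle
      exact hne (by rw [eq_of_notMem_nonstandardExponents ((binomialCon _).trans
        ((binomialCon _).symm h'.rel) h.rel) h'.standard h.standard])
    · exact h.standard (isUpperSet_nonstandardExponents hle h'.minimal.prop)

theorem IsReducedBinomial.mem_universalGroebnerBasis [Finite σ]
    (h : IsReducedBinomial m (binomialIdeal F R) a b) :
    (monomial a 1 - monomial b 1 : MvPolynomial σ F) ∈
      universalGroebnerBasis (binomialIdeal F R) :=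
  ⟨m, _, isReducedGroebnerBasis_reducedBinomials m R, a, b, h, rfl⟩

end Standard

/-- A weight on the variables for which `x^b` has weight zero and every monomial that uses a
variable outside `x^a x^b` is heavier than `x^a`. -/
noncomputable def supportWeight (a b : σ →₀ ℕ) (s : σ) : ℕ :=
  if b s ≠ 0 then 0 else if a s ≠ 0 then 1 else a.degree + 1

theorem weight_supportWeight_eq_zero_iff {a b d : σ →₀ ℕ} :
    Finsupp.weight (supportWeight a b) d = 0 ↔ d.support ⊆ b.support := by
  simp only [Finsupp.weight_apply, Finsupp.sum, smul_eq_mul, Finset.sum_eq_zero_iff,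
    mul_eq_zero, Finset.subset_iff, Finsupp.mem_support_iff, supportWeight]
  refine forall₂_congr fun s hs => ?_
  split_ifs <;> simp_all

theorem weight_supportWeight_le_degree (a b : σ →₀ ℕ) :
    Finsupp.weight (supportWeight a b) a ≤ a.degree := by
  rw [Finsupp.weight_apply, Finsupp.degree_apply]
  refine Finset.sum_le_sum fun s hs => ?_
  have hs : a s ≠ 0 := Finsupp.mem_support_iff.1 hs
  have hle : supportWeight a b s ≤ 1 := by
    unfold supportWeight
    split_ifs <;> omega
  exact mul_le_of_le_one_right' hle

theorem support_subset_of_weight_supportWeight_le {a b d : σ →₀ ℕ}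
    (h : Finsupp.weight (supportWeight a b) d ≤ Finsupp.weight (supportWeight a b) a) {s : σ}
    (hs : d s ≠ 0) : a s ≠ 0 ∨ b s ≠ 0 := by
  by_contra! hab
  have hle := (Finsupp.le_weight_of_ne_zero' (supportWeight a b) hs).trans
    (h.trans (weight_supportWeight_le_degree a b))
  rw [supportWeight, if_neg (not_not.2 hab.2), if_neg (not_not.2 hab.1)] at hle
  exact absurd hle (Nat.not_succ_le_self _)

theorem mem_universalGroebnerBasis_of_support [Finite σ] {a b : σ →₀ ℕ}
    (hab : binomialCon (binomialIdeal F R) a b) (hne : a ≠ b)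
    (hb : ∀ d, binomialCon (binomialIdeal F R) b d → d.support ⊆ b.support → d = b)
    (ha : ∀ c d, binomialCon (binomialIdeal F R) c d → c ≠ d → c ≤ a →
      (∀ s, d s ≠ 0 → a s ≠ 0 ∨ b s ≠ 0) → c = a) :
    (monomial a 1 - monomial b 1 : MvPolynomial σ F) ∈
      universalGroebnerBasis (binomialIdeal F R) := by
  obtain ⟨m, hm⟩ := exists_monomialOrder_of_weight (Finsupp.weight (supportWeight a b))
  have hb_std : b ∉ nonstandardExponents m (binomialIdeal F R) := fun ⟨d, hbd, hlt⟩ => by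
    have hweight : Finsupp.weight (supportWeight a b) d = 0 := Nat.eq_zero_of_le_zero
      ((hm d b hlt.le).trans_eq (weight_supportWeight_eq_zero_iff.2 subset_rfl))
    exact hlt.ne (congrArg m.toSyn (hb d hbd (weight_supportWeight_eq_zero_iff.1 hweight)))
  have ha_nonstd : a ∈ nonstandardExponents m (binomialIdeal F R) :=
    ⟨b, hab, lt_of_le_of_ne (le_of_notMem_nonstandardExponents hab hb_std)
      (m.toSyn.injective.ne hne.symm)⟩
  have ha_min : Minimal (· ∈ nonstandardExponents m (binomialIdeal F R)) a :=
    ⟨ha_nonstd, fun c ⟨d, hcd, hlt⟩ hca => (ha c d hcd (fun h => hlt.ne' (congrArg m.toSyn h)) hca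
      fun s => support_subset_of_weight_supportWeight_le
        (hm d a (hlt.le.trans (m.toSyn_monotone hca)))).ge⟩
  exact IsReducedBinomial.mem_universalGroebnerBasis ⟨ha_min, hb_std, hab⟩

end BinomialIdeal

section ParityCongruence

variable {V : Type u}

/-- The moves on exponents that exchange `x_i x_j` for `y_i y_j`, for an edge `{i, j}` of `G`. -/
def EdgeMove (G : SimpleGraph V) (a b : V ⊕ V →₀ ℕ) : Prop :=
  ∃ i j, G.Adj i j ∧ a = Finsupp.single (Sum.inl i) 1 + Finsupp.single (Sum.inl j) 1 ∧
    b = Finsupp.single (Sum.inr i) 1 + Finsupp.single (Sum.inr j) 1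

/-- The congruence on exponents generated by the moves along the edges of `G`. -/
noncomputable def parityCon (G : SimpleGraph V) : AddCon (V ⊕ V →₀ ℕ) :=
  addConGen (EdgeMove G)

theorem parityBinomialEdgeIdeal_eq_binomialIdeal (F : Type v) [Field F] (G : SimpleGraph V) :
    parityBinomialEdgeIdeal F G = binomialIdeal F (EdgeMove G) := by
  have hmonomial (r s : V ⊕ V) : (X r * X s : MvPolynomial (V ⊕ V) F) =
      monomial (Finsupp.single r 1 + Finsupp.single s 1) 1 := by
    rw [X, X, monomial_mul, mul_one]
  refine congrArg Ideal.span (Set.ext fun f => ⟨?_, ?_⟩)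
  · rintro ⟨i, j, hij, rfl⟩
    refine ⟨_, _, ⟨i, j, hij, rfl, rfl⟩, ?_⟩
    simp only [xVar, yVar, hmonomial]
  · rintro ⟨_, _, ⟨i, j, hij, rfl, rfl⟩, rfl⟩
    refine ⟨i, j, hij, ?_⟩
    simp only [xVar, yVar, hmonomial]

theorem binomialCon_parityBinomialEdgeIdeal (F : Type v) [Field F] (G : SimpleGraph V) :
    binomialCon (parityBinomialEdgeIdeal F G) = parityCon G := by
  rw [parityBinomialEdgeIdeal_eq_binomialIdeal, binomialCon_binomialIdeal, parityCon]

/-- The vertex `i` of a variable `x_i` or `y_i`. -/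
def varVertex : V ⊕ V → V :=
  Sum.elim id id

@[simp]
theorem varVertex_swap (r : V ⊕ V) : varVertex r.swap = varVertex r := by
  cases r <;> rfl

theorem eq_or_eq_swap_of_varVertex_eq {r s : V ⊕ V} (h : varVertex r = varVertex s) :
    r = s ∨ r = s.swap := by
  cases r <;> cases s <;> simp_all [varVertex]

theorem swap_ne_self (r : V ⊕ V) : r.swap ≠ r := by
  cases r <;> simp

/-- Values of the variables for which `x_i x_j` and `y_i y_j` have the same weight for every edge
`{i, j}` of `G`. -/
def IsParityWeight {M : Type*} [Add M] (G : SimpleGraph V) (w : V ⊕ V → M) : Prop :=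
  ∀ ⦃i j⦄, G.Adj i j → w (Sum.inl i) + w (Sum.inl j) = w (Sum.inr i) + w (Sum.inr j)

variable {G : SimpleGraph V} {M : Type*}

theorem isParityWeight_mk_parityCon (G : SimpleGraph V) :
    IsParityWeight G fun r => (parityCon G).mk' (Finsupp.single r 1) := fun i j hij => by
  rw [← map_add, ← map_add]
  exact (AddCon.eq _).2 (AddConGen.Rel.of _ _ ⟨i, j, hij, rfl, rfl⟩)

theorem IsParityWeight.weight_eq [AddCommMonoid M] {w : V ⊕ V → M} (hw : IsParityWeight G w)
    {a b : V ⊕ V →₀ ℕ} (h : parityCon G a b) : Finsupp.weight w a = Finsupp.weight w b := by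
  suffices hle : parityCon G ≤ AddCon.ker (Finsupp.weight w : (V ⊕ V →₀ ℕ) →+ M) from hle h
  refine AddCon.addConGen_le.2 ?_
  rintro _ _ ⟨i, j, hij, rfl, rfl⟩
  simpa only [AddCon.ker_rel, map_add, Finsupp.weight_single, one_smul] using hw hij

/- Outside of `W`, the weight can be extended by `⊤`. -/
theorem weight_eq_of_support_subset [AddCommMonoid M] {w : V ⊕ V → M} {W : Set V}
    (hw : ∀ i ∈ W, ∀ j ∈ W, G.Adj i j →
      w (Sum.inl i) + w (Sum.inl j) = w (Sum.inr i) + w (Sum.inr j))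
    {a b : V ⊕ V →₀ ℕ} (h : parityCon G a b) (ha : ∀ r, a r ≠ 0 → varVertex r ∈ W)
    (hb : ∀ r, b r ≠ 0 → varVertex r ∈ W) : Finsupp.weight w a = Finsupp.weight w b := by
  classical
  let wTop : V ⊕ V → WithTop M := fun r => if varVertex r ∈ W then (w r : WithTop M) else ⊤
  have hwTop : IsParityWeight G wTop := by
    intro i j hij
    by_cases hi : i ∈ W <;> by_cases hj : j ∈ W
    · simp [wTop, varVertex, hi, hj, ← WithTop.coe_add, hw i hi j hj hij]
    all_goals simp [wTop, varVertex, hi, hj]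
  have hcoe {c : V ⊕ V →₀ ℕ} (hc : ∀ r, c r ≠ 0 → varVertex r ∈ W) :
      Finsupp.weight wTop c = (Finsupp.weight w c : M) := by
    rw [Finsupp.weight_apply, Finsupp.weight_apply, Finsupp.sum, Finsupp.sum, WithTop.coe_sum]
    refine Finset.sum_congr rfl fun r hr => ?_
    rw [WithTop.coe_nsmul]
    exact congrArg _ (if_pos (hc r (Finsupp.mem_support_iff.1 hr)))
  exact WithTop.coe_injective (by rw [← hcoe ha, ← hcoe hb, hwTop.weight_eq h])

theorem IsParityWeight.add_eq_add_swap [AddCommMonoid M] {w : V ⊕ V → M}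
    (hw : IsParityWeight G w) {p q : V ⊕ V} (hadj : G.Adj (varVertex p) (varVertex q))
    (hside : p.isLeft = q.isLeft) : w p + w q = w p.swap + w q.swap := by
  cases p <;> cases q <;> first | exact hw hadj | exact (hw hadj).symm | simp at hside

theorem IsParityWeight.add_add_eq_add_add_swap [AddCommMonoid M] {w : V ⊕ V → M}
    (hw : IsParityWeight G w) {p q t : V ⊕ V} (hpt : G.Adj (varVertex p) (varVertex t))
    (hqt : G.Adj (varVertex q) (varVertex t)) (hside : p.isLeft ≠ q.isLeft) :
    w p + w q + w t = w p.swap + w q.swap + w t := by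
  wlog hpt' : p.isLeft = t.isLeft generalizing p q
  · have hqt' : q.isLeft = t.isLeft := by
      cases p <;> cases q <;> cases t <;> simp_all
    rw [add_comm (w p), this hqt hpt hside.symm hqt', add_comm (w q.swap)]
  have hqt' : q.isLeft = t.swap.isLeft := by
    cases p <;> cases q <;> cases t <;> simp_all
  have hq := hw.add_eq_add_swap (q := t.swap) (by simpa using hqt) hqt'
  rw [Sum.swap_swap] at hq
  calc w p + w q + w t
    _ = w p + w t + w q := add_right_comm _ _ _
    _ = w p.swap + (w q + w t.swap) := by rw [hw.add_eq_add_swap hpt hpt']; abel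
    _ = w p.swap + w q.swap + w t := by rw [hq]; abel

theorem IsParityWeight.two_nsmul_add_add_eq [AddCommMonoid M] {w : V ⊕ V → M}
    (hw : IsParityWeight G w) {p t u : V ⊕ V} (hpt : G.Adj (varVertex p) (varVertex t))
    (hpu : G.Adj (varVertex p) (varVertex u)) (htu : G.Adj (varVertex t) (varVertex u)) :
    w p + w p + w t + w u = w p.swap + w p.swap + w t + w u := by
  have hswap_t : varVertex t.swap = varVertex t := varVertex_swap t
  by_cases hside : p.isLeft = t.isLeft
  · have heven := hw.add_add_eq_add_add_swap (p := p) (q := t.swap) hpu (by rwa [hswap_t])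
      (by cases p <;> cases t <;> simp_all)
    rw [Sum.swap_swap] at heven
    calc w p + w p + w t + w u
      _ = w p + (w p + w t) + w u := by abel
      _ = w p.swap + (w p + w t.swap + w u) := by rw [hw.add_eq_add_swap hpt hside]; abel
      _ = w p.swap + w p.swap + w t + w u := by rw [heven]; abel
  · have hodd := hw.add_eq_add_swap (p := p) (q := t.swap) (by rwa [hswap_t])
      (by cases p <;> cases t <;> simp_all)
    rw [Sum.swap_swap] at hodd
    calc w p + w p + w t + w u
      _ = w p + (w p + w t + w u) := by abel
      _ = w p.swap + (w p + w t.swap) + w u := by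
        rw [hw.add_add_eq_add_add_swap hpu htu hside]; abel
      _ = w p.swap + w p.swap + w t + w u := by rw [hodd]; abel

end ParityCongruence

section Difference

variable {V : Type u} {a b : V ⊕ V →₀ ℕ} {r : V ⊕ V}

theorem add_swap_eq_of_parityCon {G : SimpleGraph V} (h : parityCon G a b) (r : V ⊕ V) :
    a r + a r.swap = b r + b r.swap := by
  classical
  let w : V ⊕ V → ℕ := Pi.single r 1 + Pi.single r.swap 1
  have hw : IsParityWeight G w := fun i j _ => by
    cases r <;> simp [w, Pi.single_apply]
  have hweight (c : V ⊕ V →₀ ℕ) : Finsupp.weight w c = c r + c r.swap := by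
    simp only [w, Finsupp.weight_apply, Finsupp.sum, Pi.add_apply, Pi.single_apply, smul_eq_mul,
      mul_add, Finset.sum_add_distrib, mul_ite, mul_one, mul_zero, Finset.sum_ite_eq',
      Finsupp.mem_support_iff]
    split_ifs <;> omega
  rw [← hweight, ← hweight, hw.weight_eq h]

theorem sub_swap_apply_of_parityCon {G : SimpleGraph V} (h : parityCon G a b) (r : V ⊕ V) :
    (a - b) r.swap = (b - a) r := by
  have := add_swap_eq_of_parityCon h r
  rw [Finsupp.tsub_apply, Finsupp.tsub_apply]
  omega

theorem sub_swap_eq_zero_of_parityCon {G : SimpleGraph V} (h : parityCon G a b)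
    (hr : (a - b) r ≠ 0) : (a - b) r.swap = 0 := by
  rw [sub_swap_apply_of_parityCon h]
  rw [Finsupp.tsub_apply] at hr ⊢
  omega

theorem eq_of_sub_eq_zero_of_parityCon {G : SimpleGraph V} (h : parityCon G a b)
    (hr : (a - b) r = 0) (hr' : (a - b) r.swap = 0) : a r = b r := by
  rw [sub_swap_apply_of_parityCon h] at hr'
  rw [Finsupp.tsub_apply] at hr hr'
  omega

theorem sub_ne_zero_of_parityCon {G : SimpleGraph V} (h : parityCon G a b) (hab : a ≠ b) :
    a - b ≠ 0 := by
  contrapose! hab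
  ext r
  exact eq_of_sub_eq_zero_of_parityCon h (by rw [hab]; rfl) (by rw [hab]; rfl)

/- Cancel the common part of `a` and `b`: what remains of `b` is the swap of what remains of `a`. -/
theorem weight_sub_eq_weight_swap_sub {M : Type*} [AddCancelCommMonoid M] {w : V ⊕ V → M}
    {G : SimpleGraph V} (h : parityCon G a b) (hw : Finsupp.weight w a = Finsupp.weight w b) :
    Finsupp.weight w (a - b) = Finsupp.weight (w ∘ Sum.swap) (a - b) := by
  have hsup : a + (b - a) = b + (a - b) := by
    ext r
    simp only [Finsupp.add_apply, Finsupp.tsub_apply]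
    omega
  have hswap : b - a = Finsupp.mapDomain Sum.swap (a - b) := by
    ext r
    rw [← sub_swap_apply_of_parityCon h, ← Finsupp.mapDomain_apply Sum.swap_leftInverse.injective,
      Sum.swap_swap]
  have hweight := congrArg (Finsupp.weight w) hsup
  rw [map_add, map_add, hw, add_left_cancel_iff, hswap] at hweight
  exact hweight.symm.trans (Finsupp.linearCombination_mapDomain ..)

theorem even_degree_sub_of_parityCon {G : SimpleGraph V} (h : parityCon G a b) :
    Even (a - b).degree := by
  let w : V ⊕ V → ZMod 2 := fun r => if r.isLeft then 1 else 0
  have hw : IsParityWeight G w := fun _ _ _ => CharTwo.add_self_eq_zero 1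
  have hdegree : ((a - b).degree : ZMod 2) =
      Finsupp.weight w (a - b) + Finsupp.weight (w ∘ Sum.swap) (a - b) := by
    have hsum (r : V ⊕ V) : w r + w r.swap = 1 := by
      cases r <;> simp [w]
    simp only [Finsupp.degree_apply, Finsupp.weight_apply, Finsupp.sum, Function.comp_apply,
      ← Finset.sum_add_distrib, ← smul_add, hsum, nsmul_one, Nat.cast_sum]
  rw [← ZMod.natCast_eq_zero_iff_even, hdegree,
    ← weight_sub_eq_weight_swap_sub h (hw.weight_eq h), CharTwo.add_self_eq_zero]

/-- The sign of a variable, `1` for `x_i` and `-1` for `y_i`, reversed at all vertices other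
than `v`. On a graph with the vertices `v` and `u` only, it is a parity weight. -/
def signAt [DecidableEq V] (v : V) (r : V ⊕ V) : ℤ :=
  (if varVertex r = v then 1 else -1) * if r.isLeft then 1 else -1

theorem signAt_swap [DecidableEq V] (v : V) (r : V ⊕ V) : signAt v r.swap = -signAt v r := by
  rw [signAt, varVertex_swap, signAt]
  cases r <;> simp

theorem signAt_ne_zero [DecidableEq V] (v : V) (r : V ⊕ V) : signAt v r ≠ 0 := by
  unfold signAt
  split_ifs <;> decide

theorem signAt_eq_of_isLeft_ne [DecidableEq V] {r s : V ⊕ V} (hv : varVertex r ≠ varVertex s)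
    (hs : r.isLeft ≠ s.isLeft) : signAt (varVertex s) r = signAt (varVertex s) s := by
  have hsign : r.isLeft = !s.isLeft := by
    cases r <;> cases s <;> simp_all
  cases s <;> simp [signAt, hv, hsign]

theorem weight_signAt_sub_eq_zero [DecidableEq V] (h : parityCon (⊤ : SimpleGraph V) a b)
    {v u : V} (ha : ∀ r, a r ≠ 0 → varVertex r = v ∨ varVertex r = u) :
    Finsupp.weight (signAt v) (a - b) = 0 := by
  have hb (r : V ⊕ V) (hr : b r ≠ 0) : varVertex r = v ∨ varVertex r = u := by
    have hdeg := add_swap_eq_of_parityCon h r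
    by_cases har : a r = 0
    · exact varVertex_swap r ▸ ha r.swap (by omega)
    · exact ha r har
  have hw : Finsupp.weight (signAt v) a = Finsupp.weight (signAt v) b := by
    refine weight_eq_of_support_subset (W := {v, u}) ?_ h ha hb
    rintro i (rfl | rfl) j (rfl | rfl) hij <;>
      simp_all [signAt, varVertex, hij.ne, hij.ne']
  have hswap := weight_sub_eq_weight_swap_sub h hw
  have hneg : signAt v ∘ Sum.swap = -signAt v := funext (signAt_swap v)
  simp only [hneg, Finsupp.weight_apply, Finsupp.sum, Pi.neg_apply, smul_neg,
    Finset.sum_neg_distrib] at hswap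
  simpa only [Finsupp.weight_apply, Finsupp.sum] using self_eq_neg.1 hswap

theorem exists_varVertex_ne_of_parityCon (h : parityCon (⊤ : SimpleGraph V) a b) {p : V ⊕ V}
    (hp : (a - b) p ≠ 0) (hside : ∀ r s, (a - b) r ≠ 0 → (a - b) s ≠ 0 →
      r.isLeft = s.isLeft → varVertex r = varVertex s) (u : V) :
    ∃ t, a t ≠ 0 ∧ varVertex t ≠ varVertex p ∧ varVertex t ≠ u := by
  classical
  by_contra! hsupp
  have hzero : Finsupp.weight (signAt (varVertex p)) (a - b) = 0 :=
    weight_signAt_sub_eq_zero h (u := u) fun r hr => or_iff_not_imp_left.2 (hsupp r hr)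
  have hconst : ∀ r ∈ (a - b).support, signAt (varVertex p) r = signAt (varVertex p) p := by
    intro r hr
    have hr := Finsupp.mem_support_iff.1 hr
    by_cases hv : varVertex r = varVertex p
    · obtain rfl | rfl := eq_or_eq_swap_of_varVertex_eq hv
      · rfl
      · exact absurd (sub_swap_eq_zero_of_parityCon h hp) hr
    · exact signAt_eq_of_isLeft_ne hv fun hs => hv (hside r p hr hp hs)
  rw [Finsupp.weight_apply, Finsupp.sum, Finset.sum_congr rfl fun r hr => by rw [hconst r hr],
    ← Finset.sum_smul, smul_eq_zero_iff_left (signAt_ne_zero _ _)] at hzero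
  exact hp ((Finset.sum_eq_zero_iff.1 hzero) p (Finsupp.mem_support_iff.2 hp))

end Difference

theorem single_add_single_le {σ : Type*} {c : σ →₀ ℕ} {p q : σ} (hp : c p ≠ 0) (hq : c q ≠ 0)
    (hpq : p ≠ q) : Finsupp.single p 1 + Finsupp.single q 1 ≤ c := by
  classical
  intro r
  simp only [Finsupp.add_apply, Finsupp.single_apply]
  split_ifs <;> simp_all <;> omega

section PathMove

variable {V : Type u} [DecidableEq V]

/-- The number of interior vertices of the minimal `(i, j)`-paths of odd or even length in a
complete graph. -/
def interiorCard (i j : V) (odd : Prop) [Decidable odd] : ℕ :=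
  if i = j then if odd then 2 else 0 else if odd then 0 else 1

/-- The combinatorial data of a binomial attached to a minimal path of a complete graph: the
variables of `x_i x_j` (odd paths) or `x_i y_j` (even paths), which `Sum.swap` exchanges for the
variables of `y_i y_j` or `y_i x_j`, and one variable for each interior vertex. The field
`snd_ne` excludes the even closed paths, whose binomial is zero. -/
@[ext]
structure PathMove (V : Type u) [DecidableEq V] where
  fst : V ⊕ V
  snd : V ⊕ V
  interior : Finset (V ⊕ V)
  snd_ne : snd ≠ fst.swap
  injOn_interior : Set.InjOn varVertex (interior : Set (V ⊕ V))
  varVertex_ne_fst : ∀ t ∈ interior, varVertex t ≠ varVertex fst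
  varVertex_ne_snd : ∀ t ∈ interior, varVertex t ≠ varVertex snd
  card_interior : interior.card =
    interiorCard (varVertex fst) (varVertex snd) (fst.isLeft = snd.isLeft)

namespace PathMove

/-- The exponent of the first monomial of the binomial of a path. -/
noncomputable def source (M : PathMove V) : V ⊕ V →₀ ℕ :=
  Finsupp.single M.fst 1 + Finsupp.single M.snd 1 + ∑ t ∈ M.interior, Finsupp.single t 1

/-- The path move with the two monomials of its binomial exchanged. -/
def symm (M : PathMove V) : PathMove V where
  fst := M.fst.swap
  snd := M.snd.swap
  interior := M.interior
  snd_ne h := M.snd_ne (Sum.swap_leftInverse.injective h)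
  injOn_interior := M.injOn_interior
  varVertex_ne_fst t ht := by simpa only [varVertex_swap] using M.varVertex_ne_fst t ht
  varVertex_ne_snd t ht := by simpa only [varVertex_swap] using M.varVertex_ne_snd t ht
  card_interior := by
    rw [M.card_interior, varVertex_swap, varVertex_swap]
    cases M.fst <;> cases M.snd <;> simp

/-- The exponent of the second monomial of the binomial of a path. -/
noncomputable def target (M : PathMove V) : V ⊕ V →₀ ℕ :=
  M.symm.source

theorem symm_symm (M : PathMove V) : M.symm.symm = M := by
  simp only [symm, Sum.swap_swap]

theorem source_apply (M : PathMove V) (r : V ⊕ V) : M.source r =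
    Finsupp.single M.fst 1 r + Finsupp.single M.snd 1 r + if r ∈ M.interior then 1 else 0 := by
  simp only [source, Finsupp.add_apply, Finsupp.finsetSum_apply, Finsupp.single_apply,
    Finset.sum_ite_eq']

theorem source_apply_ne_zero_iff (M : PathMove V) {r : V ⊕ V} :
    M.source r ≠ 0 ↔ r = M.fst ∨ r = M.snd ∨ r ∈ M.interior := by
  simp only [source_apply, Finsupp.single_apply, eq_comm (b := r)]
  split_ifs <;> simp_all

theorem target_apply_ne_zero_iff (M : PathMove V) {r : V ⊕ V} :
    M.target r ≠ 0 ↔ r = M.fst.swap ∨ r = M.snd.swap ∨ r ∈ M.interior :=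
  M.symm.source_apply_ne_zero_iff

theorem target_fst (M : PathMove V) : M.target M.fst = 0 := by
  by_contra h
  rcases M.target_apply_ne_zero_iff.1 h with h | h | h
  · exact swap_ne_self _ h.symm
  · exact M.snd_ne (by rw [h, Sum.swap_swap])
  · exact M.varVertex_ne_fst _ h rfl

theorem source_ne_target (M : PathMove V) : M.source ≠ M.target := fun h =>
  M.source_apply_ne_zero_iff.2 (Or.inl rfl) (h ▸ M.target_fst)

theorem parityCon_source_target (M : PathMove V) :
    parityCon (⊤ : SimpleGraph V) M.source M.target := by
  have hw := isParityWeight_mk_parityCon (⊤ : SimpleGraph V)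
  refine (AddCon.eq _).1 (?_ : (parityCon ⊤).mk' _ = (parityCon ⊤).mk' _)
  simp only [target, source, symm, map_add, map_sum]
  have hcard := M.card_interior
  by_cases hv : varVertex M.fst = varVertex M.snd
  · obtain hfst | hfst := eq_or_eq_swap_of_varVertex_eq hv.symm
    · rw [hfst, interiorCard, if_pos rfl, if_pos rfl] at hcard
      obtain ⟨t, s, hts, hint⟩ := Finset.card_eq_two.1 hcard
      have htM : t ∈ M.interior := by simp [hint]
      have hsM : s ∈ M.interior := by simp [hint]
      rw [hint, Finset.sum_pair hts, hfst, ← add_assoc, ← add_assoc]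
      exact hw.two_nsmul_add_add_eq (M.varVertex_ne_fst t htM).symm (M.varVertex_ne_fst s hsM).symm
        (M.injOn_interior.ne htM hsM hts)
    · exact absurd hfst M.snd_ne
  · by_cases hside : M.fst.isLeft = M.snd.isLeft
    · rw [interiorCard, if_neg hv, if_pos hside, Finset.card_eq_zero] at hcard
      rw [hcard, hw.add_eq_add_swap hv hside]
    · rw [interiorCard, if_neg hv, if_neg hside] at hcard
      obtain ⟨t, hint⟩ := Finset.card_eq_one.1 hcard
      have htM : t ∈ M.interior := by simp [hint]
      rw [hint, Finset.sum_singleton]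
      exact hw.add_add_eq_add_add_swap (M.varVertex_ne_fst t htM).symm
        (M.varVertex_ne_snd t htM).symm hside

theorem fst_eq_or_eq_of_source_le {M N : PathMove V} (hle : N.source ≤ M.source)
    (hsupp : ∀ r, N.target r ≠ 0 → M.source r ≠ 0 ∨ M.target r ≠ 0) :
    N.fst = M.fst ∨ N.fst = M.snd := by
  have hfst : M.source N.fst ≠ 0 :=
    ((Nat.pos_of_ne_zero (N.source_apply_ne_zero_iff.2 (Or.inl rfl))).trans_le (hle _)).ne'
  have hswap := hsupp N.fst.swap (N.target_apply_ne_zero_iff.2 (Or.inl rfl))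
  rw [source_apply_ne_zero_iff] at hfst
  rw [source_apply_ne_zero_iff, target_apply_ne_zero_iff] at hswap
  by_contra! hne
  have hint : N.fst ∈ M.interior := by tauto
  have hvfst := M.varVertex_ne_fst _ hint
  have hvsnd := M.varVertex_ne_snd _ hint
  rw [← varVertex_swap N.fst] at hvfst hvsnd
  have hint' : N.fst.swap ∈ M.interior := by
    rcases hswap with (h | h | h) | (h | h | h) <;> simp_all
  exact swap_ne_self _ (M.injOn_interior hint' hint (varVertex_swap _))

/-- The path move of the reversed path. -/
def reverse (M : PathMove V) : PathMove V where
  fst := M.snd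
  snd := M.fst
  interior := M.interior
  snd_ne h := M.snd_ne (by rw [h, Sum.swap_swap])
  injOn_interior := M.injOn_interior
  varVertex_ne_fst := M.varVertex_ne_snd
  varVertex_ne_snd := M.varVertex_ne_fst
  card_interior := by
    simp only [M.card_interior, interiorCard, eq_comm]

theorem source_reverse (M : PathMove V) : M.reverse.source = M.source := by
  rw [source, source, add_comm (Finsupp.single M.reverse.fst 1)]
  rfl

theorem target_reverse (M : PathMove V) : M.reverse.target = M.target :=
  M.symm.source_reverse

theorem eq_of_source_le_of_fst_eq {M N : PathMove V} (hfst : N.fst = M.fst)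
    (hle : N.source ≤ M.source)
    (hsupp : ∀ r, N.target r ≠ 0 → M.source r ≠ 0 ∨ M.target r ≠ 0) : N = M := by
  have hsnd : N.snd = M.snd := by
    obtain h | h := fst_eq_or_eq_of_source_le (M := M) (N := N.reverse)
      (by rwa [source_reverse]) (by rwa [target_reverse])
    · change N.snd = M.fst at h
      by_contra hne
      have hint : M.fst ∉ M.interior := fun hint => M.varVertex_ne_fst _ hint rfl
      have hdouble := hle M.fst
      rw [h] at hne
      simp only [source_apply, hfst, h, Finsupp.single_eq_same, Finsupp.single_eq_of_ne hne, hint,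
        if_false] at hdouble
      omega
    · exact h
  have hsub : N.interior ⊆ M.interior := fun t ht => by
    have htM : M.source t ≠ 0 := ((Nat.pos_of_ne_zero
      (N.source_apply_ne_zero_iff.2 (Or.inr (Or.inr ht)))).trans_le (hle _)).ne'
    rcases M.source_apply_ne_zero_iff.1 htM with rfl | rfl | h
    · exact absurd (congrArg _ hfst.symm) (N.varVertex_ne_fst _ ht)
    · exact absurd (congrArg _ hsnd.symm) (N.varVertex_ne_snd _ ht)
    · exact h
  have hcard : N.interior.card = M.interior.card := by
    rw [N.card_interior, M.card_interior]
    simp only [hfst, hsnd]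
  exact PathMove.ext hfst hsnd (Finset.eq_of_subset_of_card_le hsub hcard.ge)

theorem source_eq_and_target_eq_of_source_le {M N : PathMove V} (hle : N.source ≤ M.source)
    (hsupp : ∀ r, N.target r ≠ 0 → M.source r ≠ 0 ∨ M.target r ≠ 0) :
    N.source = M.source ∧ N.target = M.target := by
  obtain h | h := fst_eq_or_eq_of_source_le hle hsupp
  · rw [eq_of_source_le_of_fst_eq h hle hsupp]
    exact ⟨rfl, rfl⟩
  · rw [eq_of_source_le_of_fst_eq (M := M.reverse) h (by rwa [source_reverse])
      (by rwa [source_reverse, target_reverse])]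
    exact ⟨M.source_reverse, M.target_reverse⟩

theorem source_le {M : PathMove V} {a : V ⊕ V →₀ ℕ}
    (hends : Finsupp.single M.fst 1 + Finsupp.single M.snd 1 ≤ a)
    (hint : ∀ t ∈ M.interior, a t ≠ 0) : M.source ≤ a := by
  intro r
  by_cases hr : r ∈ M.interior
  · have hfst : M.fst ≠ r := fun h => M.varVertex_ne_fst r hr (congrArg _ h.symm)
    have hsnd : M.snd ≠ r := fun h => M.varVertex_ne_snd r hr (congrArg _ h.symm)
    simpa [source_apply, hr, hfst, hsnd] using Nat.one_le_iff_ne_zero.2 (hint r hr)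
  · rw [source_apply, if_neg hr, add_zero]
    exact hends r

theorem source_le_and_target_le {G : SimpleGraph V} {a b : V ⊕ V →₀ ℕ} (h : parityCon G a b)
    (M : PathMove V) (hends : Finsupp.single M.fst 1 + Finsupp.single M.snd 1 ≤ a - b)
    (hint : ∀ t ∈ M.interior, a t ≠ 0 ∧ b t ≠ 0) : M.source ≤ a ∧ M.target ≤ b := by
  have hends_symm : Finsupp.single M.symm.fst 1 + Finsupp.single M.symm.snd 1 ≤ b - a := by
    intro r
    have hr := hends r.swap
    rw [sub_swap_apply_of_parityCon h] at hr
    have hsingle (s : V ⊕ V) : Finsupp.single s.swap 1 r = Finsupp.single s 1 r.swap := by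
      cases s <;> cases r <;> simp [Finsupp.single_apply]
    simpa only [symm, Finsupp.add_apply, hsingle] using hr
  exact ⟨source_le (hends.trans tsub_le_self) fun t ht => (hint t ht).1,
    source_le (hends_symm.trans tsub_le_self) fun t ht => (hint t ht).2⟩

end PathMove

section Domination

variable {G : SimpleGraph V} {a b : V ⊕ V →₀ ℕ} {p q : V ⊕ V}

theorem exists_source_le_of_isLeft_eq (h : parityCon G a b) (hp : (a - b) p ≠ 0)
    (hq : (a - b) q ≠ 0) (hv : varVertex p ≠ varVertex q) (hside : p.isLeft = q.isLeft) :
    ∃ M : PathMove V, M.source ≤ a ∧ M.target ≤ b := by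
  let M : PathMove V :=
    { fst := p
      snd := q
      interior := ∅
      snd_ne := by rintro rfl; exact hv (varVertex_swap p).symm
      injOn_interior := by simp
      varVertex_ne_fst := by simp
      varVertex_ne_snd := by simp
      card_interior := by rw [interiorCard, if_neg hv, if_pos hside, Finset.card_empty] }
  exact ⟨M, M.source_le_and_target_le h (single_add_single_le hp hq (ne_of_apply_ne _ hv))
    (by simp [M])⟩

theorem exists_source_le_of_isLeft_ne (h : parityCon G a b) (hp : (a - b) p ≠ 0)
    (hq : (a - b) q ≠ 0) (hv : varVertex p ≠ varVertex q) (hside : p.isLeft ≠ q.isLeft)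
    {t : V ⊕ V} (htp : varVertex t ≠ varVertex p) (htq : varVertex t ≠ varVertex q)
    (hta : a t ≠ 0) (htb : b t ≠ 0) : ∃ M : PathMove V, M.source ≤ a ∧ M.target ≤ b := by
  let M : PathMove V :=
    { fst := p
      snd := q
      interior := {t}
      snd_ne := by rintro rfl; exact hv (varVertex_swap p).symm
      injOn_interior := by simp
      varVertex_ne_fst := by simpa using htp
      varVertex_ne_snd := by simpa using htq
      card_interior := by rw [interiorCard, if_neg hv, if_neg hside, Finset.card_singleton] }
  exact ⟨M, M.source_le_and_target_le h (single_add_single_le hp hq (ne_of_apply_ne _ hv))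
    (by simpa [M] using ⟨hta, htb⟩)⟩

theorem exists_source_le_of_two_le (h : parityCon G a b) (hp : 2 ≤ (a - b) p) {t s : V ⊕ V}
    (htp : varVertex t ≠ varVertex p) (hsp : varVertex s ≠ varVertex p)
    (hst : varVertex s ≠ varVertex t) (hta : a t ≠ 0) (htb : b t ≠ 0) (hsa : a s ≠ 0)
    (hsb : b s ≠ 0) : ∃ M : PathMove V, M.source ≤ a ∧ M.target ≤ b := by
  let M : PathMove V :=
    { fst := p
      snd := p
      interior := {t, s}
      snd_ne := (swap_ne_self p).symm
      injOn_interior := by simpa [Set.injOn_pair] using fun h => absurd h.symm hst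
      varVertex_ne_fst := by simpa using ⟨htp, hsp⟩
      varVertex_ne_snd := by simpa using ⟨htp, hsp⟩
      card_interior := by
        rw [interiorCard, if_pos rfl, if_pos rfl,
          Finset.card_pair (ne_of_apply_ne _ hst.symm)] }
  refine ⟨M, M.source_le_and_target_le h ?_ (by simpa [M] using ⟨⟨hta, htb⟩, hsa, hsb⟩)⟩
  rwa [← Finsupp.single_add, Finsupp.single_le_iff]

theorem exists_source_le_and_target_le (h : parityCon (⊤ : SimpleGraph V) a b) (hab : a ≠ b) :
    ∃ M : PathMove V, M.source ≤ a ∧ M.target ≤ b := by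
  by_cases hside : ∃ p q, (a - b) p ≠ 0 ∧ (a - b) q ≠ 0 ∧ p.isLeft = q.isLeft ∧
    varVertex p ≠ varVertex q
  · obtain ⟨p, q, hp, hq, hpq, hv⟩ := hside
    exact exists_source_le_of_isLeft_eq h hp hq hv hpq
  push Not at hside
  obtain ⟨p, hp⟩ := Finsupp.ne_iff.1 (sub_ne_zero_of_parityCon h hab)
  rw [Finsupp.zero_apply] at hp
  have heq {t : V ⊕ V} (ht : ∀ r, (a - b) r ≠ 0 → varVertex r ≠ varVertex t) : a t = b t :=
    eq_of_sub_eq_zero_of_parityCon h (not_not.1 fun h => ht t h rfl)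
      (not_not.1 fun h => ht t.swap h (varVertex_swap t))
  by_cases hq : ∃ q, (a - b) q ≠ 0 ∧ varVertex p ≠ varVertex q
  · obtain ⟨q, hq, hv⟩ := hq
    have hpq : p.isLeft ≠ q.isLeft := fun hs => hv (hside p q hp hq hs)
    obtain ⟨t, hta, htp, htq⟩ := exists_varVertex_ne_of_parityCon h hp hside (varVertex q)
    have htb : a t = b t := heq fun r hr => by
      by_cases hrp : r.isLeft = p.isLeft
      · rw [hside r p hr hp hrp]
        exact htp.symm
      · rw [hside r q hr hq (by grind)]
        exact htq.symm
    exact exists_source_le_of_isLeft_ne h hp hq hv hpq htp htq hta (htb ▸ hta)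
  · push Not at hq
    have hb {t : V ⊕ V} (ht : varVertex t ≠ varVertex p) : a t = b t :=
      heq fun r hr => (hq r hr).symm ▸ ht.symm
    obtain ⟨t, hta, htp, -⟩ := exists_varVertex_ne_of_parityCon h hp hside (varVertex p)
    obtain ⟨s, hsa, hsp, hst⟩ := exists_varVertex_ne_of_parityCon h hp hside (varVertex t)
    have hsupp : a - b = Finsupp.single p ((a - b) p) := by
      refine Finsupp.eq_single_iff.2 ⟨fun r hr => Finset.mem_singleton.2 ?_, rfl⟩
      obtain rfl | rfl := eq_or_eq_swap_of_varVertex_eq (hq r (Finsupp.mem_support_iff.1 hr)).symm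
      · rfl
      · exact absurd (sub_swap_eq_zero_of_parityCon h hp) (Finsupp.mem_support_iff.1 hr)
    have heven := even_degree_sub_of_parityCon h
    rw [hsupp, Finsupp.degree_single] at heven
    exact exists_source_le_of_two_le h (by obtain ⟨k, hk⟩ := heven; omega) htp hsp hst hta
      (hb htp ▸ hta) hsa (hb hsp ▸ hsa)

end Domination

theorem exists_eq_of_mem_graverBasis {F : Type v} [Field F] {f : MvPolynomial (V ⊕ V) F}
    (hf : f ∈ graverBasis (parityBinomialEdgeIdeal F (⊤ : SimpleGraph V))) :
    ∃ M : PathMove V, f = monomial M.source 1 - monomial M.target 1 := by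
  obtain ⟨a, b, hab, rfl, hmem, hprim⟩ := hf
  have hcon {c d : V ⊕ V →₀ ℕ} : (monomial c 1 - monomial d 1 : MvPolynomial (V ⊕ V) F) ∈
      parityBinomialEdgeIdeal F (⊤ : SimpleGraph V) ↔ parityCon (⊤ : SimpleGraph V) c d := by
    rw [← binomialCon_iff, binomialCon_parityBinomialEdgeIdeal]
  obtain ⟨M, hsource, htarget⟩ := exists_source_le_and_target_le (hcon.1 hmem) hab
  obtain ⟨rfl, rfl⟩ := hprim _ _ M.source_ne_target (hcon.2 M.parityCon_source_target) hsource
    htarget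
  exact ⟨M, rfl⟩

theorem PathMove.mem_universalGroebnerBasis [Finite V] (F : Type v) [Field F]
    (M : PathMove V) : monomial M.source 1 - monomial M.target 1 ∈
      universalGroebnerBasis (parityBinomialEdgeIdeal F (⊤ : SimpleGraph V)) := by
  rw [parityBinomialEdgeIdeal_eq_binomialIdeal]
  refine mem_universalGroebnerBasis_of_support ?_ M.source_ne_target ?_ ?_ <;>
    simp only [← parityBinomialEdgeIdeal_eq_binomialIdeal, binomialCon_parityBinomialEdgeIdeal]
  · exact M.parityCon_source_target
  · intro d hd hsupp
    by_contra hne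
    obtain ⟨N, hsource, htarget⟩ := exists_source_le_and_target_le hd (Ne.symm hne)
    have hN : N.target = M.symm.target :=
      (source_eq_and_target_eq_of_source_le (M := M.symm) hsource fun r hr =>
        Or.inl (Finsupp.mem_support_iff.1 (hsupp
          (Finsupp.mem_support_iff.2 (ne_bot_of_le_ne_bot hr (htarget r)))))).2
    rw [hN, target, symm_symm] at htarget
    have hfst : d M.fst ≠ 0 :=
      ne_bot_of_le_ne_bot (M.source_apply_ne_zero_iff.2 (Or.inl rfl)) (htarget M.fst)
    exact Finsupp.mem_support_iff.1 (hsupp (Finsupp.mem_support_iff.2 hfst)) M.target_fst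
  · intro c d hcd hne hle hsupp
    obtain ⟨N, hsource, htarget⟩ := exists_source_le_and_target_le hcd hne
    have hN : N.source = M.source :=
      (source_eq_and_target_eq_of_source_le (hsource.trans hle) fun r hr =>
        hsupp r (ne_bot_of_le_ne_bot hr (htarget r))).1
    exact hle.antisymm (hN ▸ hsource)

end PathMove

section MinimalPath

variable {V : Type u} {G : SimpleGraph V}

theorem even_length_iff_of_support_subset_pair {i a : V} :
    ∀ {v w : V} (p : G.Walk v w), (∀ x ∈ p.support, x = i ∨ x = a) → (Even p.length ↔ v = w)
  | _, _, .nil, _ => by simp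
  | v, w, .cons (v := x) h p, hs => by
    have ih := even_length_iff_of_support_subset_pair p fun y hy => hs y (by simp [hy])
    have hvx : v ≠ x := h.ne
    have hv := hs v (by simp)
    have hx := hs x (by simp)
    have hw := hs w (by simp)
    rw [SimpleGraph.Walk.length_cons, Nat.even_add_one, ih]
    grind

variable [DecidableEq V] {i j : V}

theorem mem_pathInterior {p : G.Walk i j} {k : V} :
    k ∈ pathInterior p ↔ k ∈ p.support ∧ k ≠ i ∧ k ≠ j := by
  simp [pathInterior]

theorem interiorCard_le_card_pathInterior (p : G.Walk i j) :
    interiorCard i j (Odd p.length) ≤ (pathInterior p).card := by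
  have hmem {x : V} (hx : x ∈ p.support) (h : x ∉ pathInterior p) : x = i ∨ x = j := by
    rw [mem_pathInterior] at h
    tauto
  unfold interiorCard
  split_ifs with hij hodd hodd
  · by_contra! hcard
    have : Nonempty V := ⟨i⟩
    obtain ⟨a, ha⟩ := Finset.card_le_one_iff_subset_singleton.1 (Nat.le_of_lt_succ hcard)
    refine Nat.not_even_iff_odd.2 hodd
      ((even_length_iff_of_support_subset_pair (i := i) (a := a) p fun x hx => ?_).2 hij)
    by_cases hxp : x ∈ pathInterior p
    · exact Or.inr (Finset.mem_singleton.1 (ha hxp))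
    · exact Or.inl ((hmem hx hxp).elim id fun h => h.trans hij.symm)
  · exact Nat.zero_le _
  · exact Nat.zero_le _
  · rw [Nat.one_le_iff_ne_zero, Finset.card_ne_zero]
    by_contra hempty
    rw [Finset.not_nonempty_iff_eq_empty] at hempty
    exact hij ((even_length_iff_of_support_subset_pair p fun x hx =>
      hmem hx (hempty ▸ Finset.notMem_empty x)).1 (Nat.not_odd_iff_even.1 hodd))

theorem card_pathInterior_le (p : G.Walk i j) : (pathInterior p).card ≤ p.length - 1 := by
  by_cases hnil : p.Nil
  · cases hnil
    simp [pathInterior]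
  · have hsub : pathInterior p ⊆ p.support.tail.toFinset.erase j := fun k hk => by
      obtain ⟨hk, hki, hkj⟩ := mem_pathInterior.1 hk
      rw [← p.cons_tail_support, List.mem_cons] at hk
      exact Finset.mem_erase.2 ⟨hkj, List.mem_toFinset.2 (hk.resolve_left hki)⟩
    have hj : j ∈ p.support.tail.toFinset := List.mem_toFinset.2 (p.end_mem_tail_support hnil)
    calc (pathInterior p).card
      _ ≤ (p.support.tail.toFinset.erase j).card := Finset.card_le_card hsub
      _ = p.support.tail.toFinset.card - 1 := Finset.card_erase_of_mem hj
      _ ≤ p.support.tail.length - 1 := Nat.sub_le_sub_right (List.toFinset_card_le _) 1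
      _ = p.length - 1 := by rw [List.length_tail, p.length_support, Nat.add_sub_cancel]

theorem exists_walk_of_card_eq_interiorCard (odd : Prop) [Decidable odd] {K : Finset V}
    (hi : i ∉ K) (hj : j ∉ K) (hcard : K.card = interiorCard i j odd) :
    ∃ p : (⊤ : SimpleGraph V).Walk i j, (Odd p.length ↔ odd) ∧ pathInterior p = K ∧
      p.length ≤ interiorCard i j odd + 1 := by
  unfold interiorCard at hcard ⊢
  split_ifs at hcard ⊢ with hij hodd hodd
  · subst hij
    obtain ⟨k, l, hkl, rfl⟩ := Finset.card_eq_two.1 hcard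
    have hik : i ≠ k := by grind
    have hli : l ≠ i := by grind
    refine ⟨.cons hik (.cons hkl (.cons hli .nil)), by simp [hodd, Nat.odd_iff], ?_, le_rfl⟩
    ext x
    simp only [mem_pathInterior, SimpleGraph.Walk.support_cons, SimpleGraph.Walk.support_nil,
      List.mem_cons, List.not_mem_nil, Finset.mem_insert, Finset.mem_singleton]
    grind
  · subst hij
    exact ⟨.nil, by simp [hodd], by simp [pathInterior, Finset.card_eq_zero.1 hcard],
      Nat.zero_le _⟩
  · refine ⟨.cons hij .nil, by simp [hodd], ?_, le_rfl⟩
    rw [Finset.card_eq_zero.1 hcard]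
    simp [pathInterior]
  · obtain ⟨k, rfl⟩ := Finset.card_eq_one.1 hcard
    have hik : i ≠ k := by grind
    have hkj : k ≠ j := by grind
    refine ⟨.cons hik (.cons hkj .nil), by simp [hodd, Nat.odd_iff], ?_, le_rfl⟩
    ext x
    simp only [mem_pathInterior, SimpleGraph.Walk.support_cons, SimpleGraph.Walk.support_nil,
      List.mem_cons, List.not_mem_nil, Finset.mem_singleton]
    grind

theorem isMinimalPath_of_length_le {p : G.Walk i j}
    (hp : p.length ≤ interiorCard i j (Odd p.length) + 1) : IsMinimalPath p := by
  have hparity {q : G.Walk i j} (h : Even q.length ↔ Even p.length) :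
      interiorCard i j (Odd q.length) = interiorCard i j (Odd p.length) := by
    simp only [← Nat.not_even_iff_odd, h]
  have hcard := card_pathInterior_le p
  constructor
  · rintro k hk ⟨q, hq, hsub⟩
    have hlt : (pathInterior q).card < (pathInterior p).card := by
      refine Finset.card_lt_card (Finset.ssubset_iff_subset_ne.2 ⟨fun x hx => ?_, ?_⟩)
      · rw [mem_pathInterior] at hx ⊢
        exact ⟨(hsub x hx.1).1, hx.2⟩
      · intro h
        exact (hsub k (mem_pathInterior.1 (h ▸ hk)).1).2 rfl
    have := interiorCard_le_card_pathInterior q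
    rw [hparity hq] at this
    omega
  · rintro ⟨q, hlt, hq, -⟩
    have hle := (interiorCard_le_card_pathInterior q).trans (card_pathInterior_le q)
    rw [hparity hq] at hle
    grind

theorem isMinimalPath_top_iff_length_le {p : (⊤ : SimpleGraph V).Walk i j} :
    IsMinimalPath p ↔ p.length ≤ interiorCard i j (Odd p.length) + 1 := by
  refine ⟨fun hp => ?_, isMinimalPath_of_length_le⟩
  obtain ⟨K, hK, hcard⟩ := Finset.exists_subset_card_eq (interiorCard_le_card_pathInterior p)
  obtain ⟨q, hparity, hint, hlength⟩ := exists_walk_of_card_eq_interiorCard (Odd p.length)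
    (fun h => (mem_pathInterior.1 (hK h)).2.1 rfl) (fun h => (mem_pathInterior.1 (hK h)).2.2 rfl)
    hcard
  rw [← Nat.not_even_iff_odd, ← Nat.not_even_iff_odd, not_iff_not] at hparity
  suffices hpK : pathInterior q = pathInterior p from
    (not_lt.1 fun h => hp.2 ⟨q, h, hparity, hpK⟩).trans hlength
  refine hint.trans (hK.antisymm fun k hk => ?_)
  by_contra hkK
  refine hp.1 k hk ⟨q, hparity, fun w hw => ?_⟩
  rw [mem_pathInterior] at hk
  by_cases hwq : w ∈ pathInterior q
  · rw [hint] at hwq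
    exact ⟨(mem_pathInterior.1 (hK hwq)).1, ne_of_mem_of_not_mem hwq hkK⟩
  · rw [mem_pathInterior] at hwq
    have hends : w = i ∨ w = j := by tauto
    rcases hends with rfl | rfl
    · exact ⟨p.start_mem_support, hk.2.1.symm⟩
    · exact ⟨p.end_mem_support, hk.2.2.symm⟩

theorem IsMinimalPath.card_pathInterior {p : (⊤ : SimpleGraph V).Walk i j} (hp : IsMinimalPath p) :
    (pathInterior p).card = interiorCard i j (Odd p.length) := by
  have := isMinimalPath_top_iff_length_le.1 hp
  have := interiorCard_le_card_pathInterior p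
  have := card_pathInterior_le p
  omega

theorem isMinimalPath_top_iff (p : (⊤ : SimpleGraph V).Walk i j) :
    IsMinimalPath p ↔
      p.support = [i] ∨
      (i ≠ j ∧ p.support = [i, j]) ∨
      (∃ k, i ≠ j ∧ k ≠ i ∧ k ≠ j ∧ p.support = [i, k, j]) ∨
      (∃ k l, i = j ∧ k ≠ i ∧ l ≠ i ∧ k ≠ l ∧ p.support = [i, k, l, i]) := by
  rw [isMinimalPath_top_iff_length_le]
  constructor
  · intro hp
    match p with
    | .nil => exact Or.inl rfl
    | .cons hij .nil => exact Or.inr (Or.inl ⟨hij, rfl⟩)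
    | .cons (v := k) hik (.cons hkj .nil) =>
      refine Or.inr (Or.inr (Or.inl ⟨k, ?_, hik.ne', hkj.ne, rfl⟩))
      rintro rfl
      simp [interiorCard, Nat.odd_iff] at hp
    | .cons (v := k) hik (.cons (v := l) hkl (.cons hlj .nil)) =>
      obtain rfl : i = j := by
        by_contra hij
        simp [interiorCard, Nat.odd_iff, hij] at hp
      exact Or.inr (Or.inr (Or.inr ⟨k, l, rfl, hik.ne', hlj.ne, hkl.ne, rfl⟩))
    | .cons _ (.cons _ (.cons _ (.cons _ q))) =>
      simp only [SimpleGraph.Walk.length_cons, interiorCard] at hp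
      grind
  · have hlength : p.length = p.support.length - 1 := by
      rw [p.length_support, Nat.add_sub_cancel]
    rintro (h | ⟨-, h⟩ | ⟨k, hij, -, -, h⟩ | ⟨k, l, rfl, -, -, -, h⟩) <;>
      rw [hlength, h] <;> simp [interiorCard, Nat.odd_iff, *]

end MinimalPath

section PathBinomial

variable {V : Type u} [DecidableEq V] (F : Type v) [Field F]

theorem PathMove.monomial_source (M : PathMove V) :
    (monomial M.source 1 : MvPolynomial (V ⊕ V) F) = X M.fst * X M.snd * ∏ t ∈ M.interior, X t := by
  simp only [source, X, ← monomial_sum_one, monomial_mul, mul_one]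

theorem PathMove.monomial_source_sub_monomial_target (M : PathMove V) :
    (monomial M.source 1 - monomial M.target 1 : MvPolynomial (V ⊕ V) F) =
      (X M.fst * X M.snd - X M.fst.swap * X M.snd.swap) * ∏ t ∈ M.interior, X t := by
  rw [target, monomial_source, monomial_source, sub_mul]
  rfl

variable {F}

theorem mem_pathBinomials {G : SimpleGraph V} {r s : V ⊕ V}
    {p : G.Walk (varVertex r) (varVertex s)} (hodd : Odd p.length ↔ r.isLeft = s.isLeft)
    (hside : s.isLeft → r.isLeft) {t : V → MvPolynomial (V ⊕ V) F}
    (ht : ∀ k, t k = xVar F k ∨ t k = yVar F k) :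
    (X r * X s - X r.swap * X s.swap) * ∏ k ∈ pathInterior p, t k ∈ pathBinomials F p := by
  rcases r with i | i <;> rcases s with j | j
  · exact ⟨t, ht, Or.inl ⟨hodd.2 rfl, Or.inl rfl⟩⟩
  · exact ⟨t, ht, Or.inr ⟨Nat.not_odd_iff_even.1 fun h => Bool.noConfusion (hodd.1 h), rfl⟩⟩
  · exact Bool.noConfusion (hside rfl)
  · exact ⟨t, ht, Or.inl ⟨hodd.2 rfl, Or.inr rfl⟩⟩

theorem exists_eq_of_mem_pathBinomials {G : SimpleGraph V} {i j : V} {p : G.Walk i j}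
    {f : MvPolynomial (V ⊕ V) F} (hf : f ∈ pathBinomials F p) :
    ∃ (r s : V ⊕ V) (t : V → V ⊕ V), varVertex r = i ∧ varVertex s = j ∧
      (Odd p.length ↔ r.isLeft = s.isLeft) ∧ (∀ k, varVertex (t k) = k) ∧
      f = (X r * X s - X r.swap * X s.swap) * ∏ k ∈ pathInterior p, X (t k) := by
  obtain ⟨t, ht, hf⟩ := hf
  have hex (k : V) : ∃ r : V ⊕ V, varVertex r = k ∧ X r = t k :=
    (ht k).elim (fun h => ⟨_, rfl, h.symm⟩) fun h => ⟨_, rfl, h.symm⟩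
  choose u hu hut using hex
  rcases hf with ⟨hodd, rfl | rfl⟩ | ⟨heven, rfl⟩
  · exact ⟨Sum.inl i, Sum.inl j, u, rfl, rfl, by simp [hodd], hu, by simp only [hut]; rfl⟩
  · exact ⟨Sum.inr i, Sum.inr j, u, rfl, rfl, by simp [hodd], hu, by simp only [hut]; rfl⟩
  · exact ⟨Sum.inl i, Sum.inr j, u, rfl, rfl, by simp [heven], hu, by simp only [hut]; rfl⟩

theorem exists_prod_image_eq_prod_X (F : Type v) [Field F] {T : Finset (V ⊕ V)}
    (hT : Set.InjOn varVertex (T : Set (V ⊕ V))) :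
    ∃ t : V → MvPolynomial (V ⊕ V) F, (∀ k, t k = xVar F k ∨ t k = yVar F k) ∧
      ∏ k ∈ T.image varVertex, t k = ∏ r ∈ T, X r := by
  refine ⟨fun k => if Sum.inl k ∈ T then xVar F k else yVar F k, fun k => ite_eq_or_eq _ _ _, ?_⟩
  rw [Finset.prod_image hT]
  refine Finset.prod_congr rfl fun r hr => ?_
  rcases r with k | k
  · exact if_pos hr
  · exact if_neg fun hk => Sum.inl_ne_inr (hT hk hr rfl)

theorem PathMove.mem_minimalPathBinomials (F : Type v) [Field F] (M : PathMove V) :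
    monomial M.source 1 - monomial M.target 1 ∈ minimalPathBinomials F (⊤ : SimpleGraph V) := by
  wlog hside : M.snd.isLeft → M.fst.isLeft generalizing M
  · rw [← source_reverse, ← target_reverse]
    exact this M.reverse fun h => absurd (fun _ => h) hside
  obtain ⟨p, hodd, hint, hlength⟩ := exists_walk_of_card_eq_interiorCard
    (K := M.interior.image varVertex) (M.fst.isLeft = M.snd.isLeft)
    (by simpa using M.varVertex_ne_fst) (by simpa using M.varVertex_ne_snd)
    (by rw [Finset.card_image_of_injOn M.injOn_interior, M.card_interior])
  obtain ⟨t, ht, hprod⟩ := exists_prod_image_eq_prod_X F M.injOn_interior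
  refine ⟨⟨_, _, p, isMinimalPath_of_length_le (by simpa only [hodd] using hlength), ?_⟩, ?_⟩
  · rw [monomial_source_sub_monomial_target, ← hprod, ← hint]
    exact mem_pathBinomials hodd hside ht
  · exact sub_ne_zero.2 fun h => M.source_ne_target (monomial_left_injective one_ne_zero h)

theorem exists_pathMove_of_mem_minimalPathBinomials {f : MvPolynomial (V ⊕ V) F}
    (hf : f ∈ minimalPathBinomials F (⊤ : SimpleGraph V)) :
    ∃ M : PathMove V, f = monomial M.source 1 - monomial M.target 1 := by
  obtain ⟨⟨i, j, p, hp, hfp⟩, hf0⟩ := hf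
  obtain ⟨r, s, t, rfl, rfl, hodd, ht, rfl⟩ := exists_eq_of_mem_pathBinomials hfp
  have ht_inj : Function.Injective t := fun k l h => by rw [← ht k, h, ht]
  let M : PathMove V :=
    { fst := r
      snd := s
      interior := (pathInterior p).image t
      snd_ne := by
        rintro rfl
        exact hf0 (by rw [Sum.swap_swap, mul_comm (X r), sub_self, zero_mul]; rfl)
      injOn_interior := by
        intro a ha b hb hab
        simp only [Finset.coe_image] at ha hb
        obtain ⟨k, -, rfl⟩ := ha
        obtain ⟨l, -, rfl⟩ := hb
        rw [ht, ht] at hab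
        rw [hab]
      varVertex_ne_fst := by
        simpa [ht] using fun hk => (mem_pathInterior.1 hk).2.1 rfl
      varVertex_ne_snd := by
        simpa [ht] using fun hk => (mem_pathInterior.1 hk).2.2 rfl
      card_interior := by
        rw [Finset.card_image_of_injective _ ht_inj, hp.card_pathInterior]
        simp only [hodd] }
  refine ⟨M, ?_⟩
  rw [M.monomial_source_sub_monomial_target F, Finset.prod_image ht_inj.injOn]

theorem minimalPathBinomials_top (F : Type v) [Field F] :
    minimalPathBinomials F (⊤ : SimpleGraph V) =
      Set.range fun M : PathMove V => monomial M.source 1 - monomial M.target 1 :=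
  Set.ext fun _ => ⟨fun hf => (exists_pathMove_of_mem_minimalPathBinomials hf).imp
    fun _ h => h.symm, fun ⟨M, hM⟩ => hM ▸ M.mem_minimalPathBinomials F⟩

end PathBinomial

theorem mainTheorem2_general {V : Type u} [Finite V] [DecidableEq V] (F : Type v) [Field F] :
    (minimalPathBinomials F (⊤ : SimpleGraph V) =
        universalGroebnerBasis (parityBinomialEdgeIdeal F (⊤ : SimpleGraph V)) ∧
      universalGroebnerBasis (parityBinomialEdgeIdeal F (⊤ : SimpleGraph V)) =
        graverBasis (parityBinomialEdgeIdeal F (⊤ : SimpleGraph V))) ∧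
    ∀ (i j : V) (p : (⊤ : SimpleGraph V).Walk i j),
      IsMinimalPath p ↔
        p.support = [i] ∨
        (i ≠ j ∧ p.support = [i, j]) ∨
        (∃ k, i ≠ j ∧ k ≠ i ∧ k ≠ j ∧ p.support = [i, k, j]) ∨
        (∃ k l, i = j ∧ k ≠ i ∧ l ≠ i ∧ k ≠ l ∧ p.support = [i, k, l, i]) := by
  have hpath_sub : minimalPathBinomials F (⊤ : SimpleGraph V) ⊆
      universalGroebnerBasis (parityBinomialEdgeIdeal F (⊤ : SimpleGraph V)) := by
    rw [minimalPathBinomials_top]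
    exact Set.range_subset_iff.2 fun M => M.mem_universalGroebnerBasis F
  have huniv_sub : universalGroebnerBasis (parityBinomialEdgeIdeal F (⊤ : SimpleGraph V)) ⊆
      graverBasis (parityBinomialEdgeIdeal F (⊤ : SimpleGraph V)) := by
    rw [parityBinomialEdgeIdeal_eq_binomialIdeal]
    exact universalGroebnerBasis_subset_graverBasis _
  have hgraver_sub : graverBasis (parityBinomialEdgeIdeal F (⊤ : SimpleGraph V)) ⊆
      minimalPathBinomials F (⊤ : SimpleGraph V) := fun f hf => by
    obtain ⟨M, rfl⟩ := exists_eq_of_mem_graverBasis hf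
    exact M.mem_minimalPathBinomials F
  exact ⟨⟨hpath_sub.antisymm (huniv_sub.trans hgraver_sub),
    huniv_sub.antisymm (hgraver_sub.trans hpath_sub)⟩, fun i j p => isMinimalPath_top_iff p⟩

theorem mainTheorem2 (F : Type*) [Field F] (n : ℕ) :
    (minimalPathBinomials F (⊤ : SimpleGraph (Fin n)) =
        universalGroebnerBasis (parityBinomialEdgeIdeal F (⊤ : SimpleGraph (Fin n))) ∧
      universalGroebnerBasis (parityBinomialEdgeIdeal F (⊤ : SimpleGraph (Fin n))) =
        graverBasis (parityBinomialEdgeIdeal F (⊤ : SimpleGraph (Fin n)))) ∧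
    ∀ (i j : Fin n) (p : (⊤ : SimpleGraph (Fin n)).Walk i j),
      IsMinimalPath p ↔
        p.support = [i] ∨
        (i ≠ j ∧ p.support = [i, j]) ∨
        (∃ k, i ≠ j ∧ k ≠ i ∧ k ≠ j ∧ p.support = [i, k, j]) ∨
        (∃ k l, i = j ∧ k ≠ i ∧ l ≠ i ∧ k ≠ l ∧ p.support = [i, k, l, i]) :=
  mainTheorem2_general F
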